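/- **Definitions.** A set $D$ in a matroid $\mathcal M$ with rank function $r$ is *cyclic* if it is a union of circuits, and, for an integer $k\ge 0$, a *$k$-fold circuit* if it is cyclic and $r(D)=|D|-k$. The *principal partition* of a $k$-fold circuit $D$ is the partition of $D$ whose parts are the sets $D\setminus B$, where $B$ ranges over the $(k-1)$-fold circuits of $\mathcal M$ contained in $D$. Let $G=(V,E)$ be a finite simple graph and $d\ge 0$. The rigidity matrix $R(G,p)$ of $p:V\to\mathbb R^d$ has a row for each edge $uv\in E$ and $d$ columns for each vertex; the row of $uv$ is $p(u)-p(v)$ in the columns of $u$, $p(v)-p(u)$ in the columns of $v$, and $0$ elsewhere. The rigidity matroid $\mathcal R_d(G)$ is the matroid on $E$ in which $F\subseteq E$ is independent if the corresponding rows of $R(G,p)$ are linearly independent for some (equivalently, every) $p$ whose coordinates are algebraically independent over $\mathbb Q$. The graph $G$ is a *$k$-fold $\mathcal R_d$-circuit* if $E$ is a $k$-fold circuit of $\mathcal R_d(G)$; the principal partition of $G$ is then that of $E$ in $\mathcal R_d(G)$. A vertex of $G$ is *technicolour* if the edges of $G$ incident with it do not all belong to a single part of the principal partition of $G$. The *cone*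 $G*v$ is obtained from $G$ by adding a new vertex $v$ and joining it to every vertex of $G$. We write $N_G(w)$ for the set of neighbours of $w$ in $G$. **Theorem.** Let $G$ be a $k$-fold $\mathcal R_d$-circuit without isolated vertices, with principal partition $\mathcal A$, and let $u,x$ be two distinct technicolour vertices of $G$. Suppose that (a) there exists $z\in N_G(u)\cap N_G(x)$ such that $uz$ and $xz$ belong to different parts of $\mathcal A$, or (b) $N_G(u)\setminus\{x\}\neq N_G(x)\setminus\{u\}$. Then $G*v$ is a $k$-fold $\mathcal R_{d+1}$-circuit, and the edges $vu$ and $vx$ belong to different parts of its principal partition. -/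

import Mathlib

namespace Matroid

variable {α : Type*}

/-- A cyclic set of a matroid: a (possibly empty) union of circuits. -/
def IsCyclicSet (M : Matroid α) (D : Set α) : Prop :=
  ∃ S : Set (Set α), (∀ C ∈ S, M.IsCircuit C) ∧ ⋃₀ S = D

/-- A `k`-fold circuit of `M`: a cyclic set `D` with `r(D) = |D| - k`. -/
def IsKFoldCircuit (M : Matroid α) (k : ℕ) (D : Set α) : Prop :=
  M.IsCyclicSet D ∧ M.eRk D + k = D.encard

/-- The principal partition of a `k`-fold circuit `D`: the set of all complements `D \ B`,
where `B ⊆ D` is a `(k - 1)`-fold circuit (there is none when `k = 0`). -/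
def principalPartition (M : Matroid α) (k : ℕ) (D : Set α) : Set (Set α) :=
  {A | ∃ B ⊆ D, (∃ j : ℕ, j + 1 = k ∧ M.IsKFoldCircuit j B) ∧ A = D \ B}

end Matroid

/-- `e` and `f` belong to different parts of the partition `P`. -/
def InDifferentParts {α : Type*} (P : Set (Set α)) (e f : α) : Prop :=
  ∃ A ∈ P, ∃ B ∈ P, e ∈ A ∧ f ∈ B ∧ A ≠ B

namespace Rigidity

variable {V : Type*}

open Classical in
/-- The row of the rigidity matrix of the realisation `p` that belongs to the edge `uv`: it is
`p(u) - p(v)` in the columns of `u`, `p(v) - p(u)` in the columns of `v`, and zero elsewhere. -/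
noncomputable def rigidityRow {d : ℕ} (p : V → Fin d → ℝ) (e : Sym2 V) : V × Fin d → ℝ :=
  Sym2.lift ⟨fun u v => fun wi : V × Fin d =>
      (if wi.1 = u then p u wi.2 - p v wi.2 else 0) +
      (if wi.1 = v then p v wi.2 - p u wi.2 else 0),
    fun u v => by funext wi; exact add_comm _ _⟩ e

/-- The rigidity matrix of the framework `(G, p)`, with one row for each edge of `G`. -/
noncomputable def rigidityMatrix {d : ℕ} (G : SimpleGraph V) (p : V → Fin d → ℝ) :
    Matrix G.edgeSet (V × Fin d) ℝ :=
  Matrix.of fun e => rigidityRow p (e : Sym2 V)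

/-- A realisation is generic if its coordinates are algebraically independent over `ℚ`. -/
def IsGeneric {d : ℕ} (p : V → Fin d → ℝ) : Prop :=
  AlgebraicIndependent ℚ fun wi : V × Fin d => p wi.1 wi.2

/-- A set `F` of edges of `G` is independent in the `d`-dimensional rigidity matroid of `G` if the
corresponding rows of the rigidity matrix of `(G, p)` are linearly independent for some generic
realisation `p` in `ℝ^d`. -/
def IsRigidityIndep (d : ℕ) (G : SimpleGraph V) (F : Set (Sym2 V)) : Prop :=
  F ⊆ G.edgeSet ∧ ∃ p : V → Fin d → ℝ, IsGeneric p ∧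
    LinearIndepOn ℝ (rigidityMatrix G p).row {e : G.edgeSet | (e : Sym2 V) ∈ F}

/-- Generic realisations exist. -/
theorem exists_isGeneric [Finite V] (d : ℕ) : ∃ p : V → Fin d → ℝ, IsGeneric p := by
  obtain ⟨s, hs⟩ := exists_isTranscendenceBasis ℚ ℝ
  have hinf : Infinite s := by
    by_contra hfin
    have hfin' : Finite s := not_infinite_iff_finite.mp hfin
    have halg : Algebra.IsAlgebraic (Algebra.adjoin ℚ (Set.range ((↑) : s → ℝ))) ℝ :=
      hs.isAlgebraic
    have hc : Countable (Algebra.adjoin ℚ (Set.range ((↑) : s → ℝ))) := by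
      rw [Algebra.adjoin_range_eq_range_aeval]
      have : Countable (MvPolynomial s ℚ) := by
        rw [← Cardinal.mk_le_aleph0_iff]
        refine MvPolynomial.cardinalMk_le_max.trans ?_
        simp
      exact Set.countable_range (MvPolynomial.aeval ((↑) : s → ℝ))
    have h1 := Algebra.IsAlgebraic.cardinalMk_le_max
      (Algebra.adjoin ℚ (Set.range ((↑) : s → ℝ))) ℝ
    have h2 : Cardinal.mk ℝ ≤ Cardinal.aleph0 :=
      h1.trans (max_le (Cardinal.mk_le_aleph0_iff.mpr hc) le_rfl)
    rw [Cardinal.mk_real] at h2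
    exact absurd h2 (not_le.mpr Cardinal.aleph0_lt_continuum)
  obtain ⟨n, ⟨φ⟩⟩ := Finite.exists_equiv_fin (V × Fin d)
  let g : V × Fin d → s := fun x => Infinite.natEmbedding s (φ x)
  have hg : Function.Injective g := fun x y h =>
    φ.injective (Fin.val_injective ((Infinite.natEmbedding s).injective h))
  refine ⟨fun v i => (g (v, i) : ℝ), ?_⟩
  exact hs.1.comp g hg

/-- A matrix over `ℝ` has linearly independent rows if and only if its Gram determinant does not
vanish. -/
theorem linearIndependent_row_iff_det {m n : Type*} [Fintype m] [DecidableEq m] [Fintype n]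
    (A : Matrix m n ℝ) : LinearIndependent ℝ A.row ↔ (A * A.transpose).det ≠ 0 := by
  rw [← Matrix.vecMul_injective_iff, ← isUnit_iff_ne_zero, ← Matrix.isUnit_iff_isUnit_det,
    ← Matrix.vecMul_injective_iff_isUnit]
  have key : ∀ x : m → ℝ, Matrix.vecMul x (A * A.transpose) = 0 ↔ Matrix.vecMul x A = 0 := by
    intro x
    have := Matrix.vecMul_self_mul_conjTranspose_eq_zero A x
    rwa [Matrix.conjTranspose_eq_transpose_of_trivial] at this
  have h1 := injective_iff_map_eq_zero (Matrix.vecMulLinear A)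
  have h2 := injective_iff_map_eq_zero (Matrix.vecMulLinear (A * A.transpose))
  exact (h1.trans (forall_congr' fun x => imp_congr_left (key x).symm)).trans h2.symm

/-- Rows that are independent in some realisation are independent in every generic one. -/
theorem linearIndepOn_of_isGeneric [Finite V] {d : ℕ} (G : SimpleGraph V) (F : Set G.edgeSet)
    (p q : V → Fin d → ℝ) (hq : IsGeneric q)
    (hp : LinearIndepOn ℝ (rigidityMatrix G p).row F) :
    LinearIndepOn ℝ (rigidityMatrix G q).row F := by
  classical
  have := Fintype.ofFinite V
  have := Fintype.ofFinite F
  let rowP : Sym2 V → V × Fin d → MvPolynomial (V × Fin d) ℚ := fun e =>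
    Sym2.lift ⟨fun u v => fun wi : V × Fin d =>
      (if wi.1 = u then MvPolynomial.X (u, wi.2) - MvPolynomial.X (v, wi.2) else 0) +
      (if wi.1 = v then MvPolynomial.X (v, wi.2) - MvPolynomial.X (u, wi.2) else 0),
      fun u v => by funext wi; exact add_comm _ _⟩ e
  let P : Matrix F (V × Fin d) (MvPolynomial (V × Fin d) ℚ) :=
    Matrix.of fun e => rowP (e : G.edgeSet)
  let ev : (V → Fin d → ℝ) → MvPolynomial (V × Fin d) ℚ →ₐ[ℚ] ℝ := fun r =>
    MvPolynomial.aeval fun wi : V × Fin d => r wi.1 wi.2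
  have hmap : ∀ r, P.map (ev r) = Matrix.of fun e : F => (rigidityMatrix G r).row e := by
    intro r
    ext ⟨⟨e, he⟩, hF⟩ wi
    induction e using Sym2.ind with
    | _ a b =>
      simp only [P, rowP, ev, rigidityMatrix, rigidityRow, Matrix.map_apply, Matrix.of_apply,
        Sym2.lift_mk, Matrix.row]
      split_ifs <;> simp
  have hdet : ∀ r, LinearIndepOn ℝ (rigidityMatrix G r).row F ↔
      ev r ((P * P.transpose).det) ≠ 0 := by
    intro r
    have h := linearIndependent_row_iff_det (Matrix.of fun e : F => (rigidityMatrix G r).row e)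
    rw [← hmap r] at h
    have h3 : ev r ((P * P.transpose).det) = ((P.map (ev r)) * (P.map (ev r)).transpose).det := by
      rw [AlgHom.map_det, AlgHom.mapMatrix_apply, Matrix.map_mul, Matrix.transpose_map]
    rw [h3, ← h, hmap r]
    rfl
  rw [hdet] at hp ⊢
  have hne : (P * P.transpose).det ≠ 0 := fun h => hp (by rw [h, map_zero])
  intro h0
  exact hne (hq (by rw [map_zero]; exact h0))

/-- The `d`-dimensional rigidity matroid of `G`, on the edge set of `G`. -/
noncomputable def rigidityMatroid [Finite V] (d : ℕ) (G : SimpleGraph V) : Matroid (Sym2 V) :=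
  (IndepMatroid.ofFinite (Set.toFinite G.edgeSet) (IsRigidityIndep d G)
    (by
      obtain ⟨p, hp⟩ := exists_isGeneric (V := V) d
      refine ⟨Set.empty_subset _, p, hp, ?_⟩
      simp)
    (by
      rintro I J ⟨hJ, p, hp, hl⟩ hIJ
      exact ⟨hIJ.trans hJ, p, hp, hl.mono fun e he => hIJ he⟩)
    (by
      rintro I J ⟨hI, p, hp, hlI⟩ ⟨hJ, q, hq, hlJ⟩ hlt
      replace hlJ := linearIndepOn_of_isGeneric G _ q p hp hlJ
      set R := (rigidityMatrix G p).row
      set I' : Set G.edgeSet := {e | (e : Sym2 V) ∈ I} with hI'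
      set J' : Set G.edgeSet := {e | (e : Sym2 V) ∈ J} with hJ'
      have hIc : I'.ncard = I.ncard := by
        rw [← Set.ncard_image_of_injective I' Subtype.val_injective]
        congr 1
        ext e
        simpa [hI'] using fun h => hI h
      have hJc : J'.ncard = J.ncard := by
        rw [← Set.ncard_image_of_injective J' Subtype.val_injective]
        congr 1
        ext e
        simpa [hJ'] using fun h => hJ h
      have hex : ∃ e ∈ J', R e ∉ Submodule.span ℝ (R '' I') := by
        by_contra! hall
        have hle : Submodule.span ℝ (R '' J') ≤ Submodule.span ℝ (R '' I') := by
          rw [Submodule.span_le]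
          rintro _ ⟨e, he, rfl⟩
          exact hall e he
        have := Fintype.ofFinite V
        have := Fintype.ofFinite I'
        have := Fintype.ofFinite J'
        have hfI : Module.finrank ℝ (Submodule.span ℝ (R '' I')) = I'.ncard := by
          rw [Set.image_eq_range, finrank_span_eq_card hlI, Set.ncard_eq_toFinset_card',
            Set.toFinset_card]
        have hfJ : Module.finrank ℝ (Submodule.span ℝ (R '' J')) = J'.ncard := by
          rw [Set.image_eq_range, finrank_span_eq_card hlJ, Set.ncard_eq_toFinset_card',
            Set.toFinset_card]
        have := Submodule.finrank_mono hle
        omega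
      obtain ⟨e, heJ, he⟩ := hex
      have heI : e ∉ I' := fun h => he (Submodule.subset_span ⟨e, h, rfl⟩)
      refine ⟨e, heJ, heI, Set.insert_subset e.2 hI, p, hp, ?_⟩
      refine (hlI.insert he).mono ?_
      rintro f (hf | hf)
      · exact Or.inl (Subtype.ext hf)
      · exact Or.inr hf)
    (fun _ h => h.1)).matroid

@[simp] theorem rigidityMatroid_ground [Finite V] (d : ℕ) (G : SimpleGraph V) :
    (rigidityMatroid d G).E = G.edgeSet := rfl

theorem rigidityMatroid_indep_iff [Finite V] (d : ℕ) (G : SimpleGraph V) (F : Set (Sym2 V)) :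
    (rigidityMatroid d G).Indep F ↔ IsRigidityIndep d G F := by
  simp [rigidityMatroid]

/-- Independence in the rigidity matroid may be tested at any given generic realisation. -/
theorem rigidityMatroid_indep_iff_of_isGeneric [Finite V] {d : ℕ} (G : SimpleGraph V)
    (F : Set (Sym2 V)) (p : V → Fin d → ℝ) (hp : IsGeneric p) :
    (rigidityMatroid d G).Indep F ↔ F ⊆ G.edgeSet ∧
      LinearIndepOn ℝ (rigidityMatrix G p).row {e : G.edgeSet | (e : Sym2 V) ∈ F} := by
  rw [rigidityMatroid_indep_iff]
  exact ⟨fun ⟨hF, q, _, hl⟩ => ⟨hF, linearIndepOn_of_isGeneric G _ q p hp hl⟩,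
    fun ⟨hF, hl⟩ => ⟨hF, p, hp, hl⟩⟩

/-- `G` is a `k`-fold `R_d`-circuit if its edge set is a `k`-fold circuit of its `d`-dimensional
rigidity matroid. -/
def IsKFoldRigidityCircuit [Finite V] (d k : ℕ) (G : SimpleGraph V) : Prop :=
  (rigidityMatroid d G).IsKFoldCircuit k G.edgeSet

/-- The principal partition of a `k`-fold `R_d`-circuit `G`, a partition of its edges. -/
def edgePartition [Finite V] (d k : ℕ) (G : SimpleGraph V) : Set (Set (Sym2 V)) :=
  (rigidityMatroid d G).principalPartition k G.edgeSet

/-- A vertex is monochromatic with respect to the edge partition `P` if all edges of `G` incident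
with it belong to the same part. -/
def IsMonochromatic (G : SimpleGraph V) (P : Set (Set (Sym2 V))) (x : V) : Prop :=
  ∃ A ∈ P, ∀ e ∈ G.incidenceSet x, e ∈ A

/-- A vertex is technicolour if it is not monochromatic. -/
def IsTechnicolour (G : SimpleGraph V) (P : Set (Set (Sym2 V))) (x : V) : Prop :=
  ¬ IsMonochromatic G P x

/-- The cone of `G` over the new vertex `none`, which is joined to every vertex of `G`. -/
def cone (G : SimpleGraph V) : SimpleGraph (Option V) where
  Adj
    | some a, some b => G.Adj a b
    | none, none => False
    | none, some _ => True
    | some _, none => True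
  symm := ⟨by rintro (_ | a) (_ | b) h <;> first | exact h | exact G.symm.symm _ _ h⟩
  loopless := ⟨by rintro (_ | a) h <;> first | exact h | exact G.irrefl h⟩

end Rigidity

/-! Nullity is read as the dimension of the space of equilibrium stresses: a cyclic edge set is a
`k`-fold circuit exactly when this dimension is `k` at a generic realisation. Fix a generic `p` of
`G` and nonzero weights `s`. Put the cone vertex at the origin and each `w` at `(1, p(w)) / s(w)`.
Stresses of this cone framework correspond bijectively to stresses `ω` of `(G, p)`: base edges get
`s(a) s(b) ω(ab)`, and the cone edge at `a` gets `s(a)` times the linear form `vertexForm ω s a` in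
`s`. Hence coning preserves nullity, and every such special framework attains the generic rank of
the cone (`eRk_cone_add`). An edge set whose coordinates are separated by stresses of one special
framework can therefore be deleted without loss of generic rank (`eRk_cone_le_of_stress`).

Deleting a single edge in this way gives cyclicity of the cone; deleting the edges `vu` and `vx`
together puts them into different parts. The latter needs some `s` for which the vertex forms at `u`
and `x` are independent functionals of `ω` (`exists_vertexForm_ne`). If every `s` fails, all
products `F_ω H_μ` and `F_μ H_ω` of the forms at `u` and `x` agree. As `u` is technicolour, the
forms at `u` are not all multiples of one another, so `H_ω = c F_ω` with one constant `c`
(`exists_eq_smul_of_mul_eq_mul`). Comparing coefficients, `ω(xz) = c ω(uz)` for all stresses and all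
`z ≠ u, x`, with `c ≠ 0`; this contradicts both (a) and (b). -/

namespace Matroid

variable {α : Type*}

/-! ### Cyclic parts, nullity and the principal partition -/

/-- The union of the circuits contained in `X`. -/
def cyclicPart (M : Matroid α) (X : Set α) : Set α :=
  ⋃₀ {C | M.IsCircuit C ∧ C ⊆ X}

theorem isCyclicSet_cyclicPart (M : Matroid α) (X : Set α) : M.IsCyclicSet (M.cyclicPart X) :=
  ⟨_, fun _ hC => hC.1, rfl⟩

theorem cyclicPart_subset (M : Matroid α) (X : Set α) : M.cyclicPart X ⊆ X :=
  Set.sUnion_subset fun _ hC => hC.2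

theorem mem_cyclicPart_iff {M : Matroid α} {X : Set α} {e : α} :
    e ∈ M.cyclicPart X ↔ ∃ C, M.IsCircuit C ∧ C ⊆ X ∧ e ∈ C := by
  simp [cyclicPart, and_assoc]

theorem IsCircuit.subset_cyclicPart {M : Matroid α} {C X : Set α} (hC : M.IsCircuit C)
    (hCX : C ⊆ X) : C ⊆ M.cyclicPart X :=
  Set.subset_sUnion_of_mem ⟨hC, hCX⟩

theorem IsCyclicSet.exists_isCircuit {M : Matroid α} {D : Set α} (hD : M.IsCyclicSet D) {e : α}
    (he : e ∈ D) : ∃ C, M.IsCircuit C ∧ C ⊆ D ∧ e ∈ C := by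
  obtain ⟨S, hS, rfl⟩ := hD
  obtain ⟨C, hC, heC⟩ := he
  exact ⟨C, hS C hC, Set.subset_sUnion_of_mem hC, heC⟩

theorem IsCyclicSet.subset_cyclicPart {M : Matroid α} {D X : Set α} (hD : M.IsCyclicSet D)
    (hDX : D ⊆ X) : D ⊆ M.cyclicPart X := fun _ he =>
  let ⟨_, hC, hCD, heC⟩ := hD.exists_isCircuit he
  hC.subset_cyclicPart (hCD.trans hDX) heC

theorem IsCyclicSet.subset_ground {M : Matroid α} {D : Set α} (hD : M.IsCyclicSet D) :
    D ⊆ M.E := fun _ he =>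
  let ⟨_, hC, _, heC⟩ := hD.exists_isCircuit he
  hC.subset_ground heC

theorem isCyclicSet_of_forall_mem_closure {M : Matroid α} {D : Set α}
    (h : ∀ e ∈ D, e ∈ M.closure (D \ {e})) : M.IsCyclicSet D := by
  refine ⟨{C | M.IsCircuit C ∧ C ⊆ D}, fun _ hC => hC.1,
    (M.cyclicPart_subset D).antisymm fun e he => ?_⟩
  obtain ⟨C, hCs, hC, heC⟩ := (mem_closure_iff_exists_isCircuit (by simp)).1 (h e he)
  refine hC.subset_cyclicPart (hCs.trans ?_) heC
  rintro f (rfl | hf)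
  exacts [he, hf.1]

/-- Finiteness of `X` makes the rank finite; otherwise adding one to it need not increase it. -/
theorem mem_closure_of_eRk_insert_le {M : Matroid α} {X : Set α} {e : α} (hX : X.Finite)
    (he : e ∈ M.E) (h : M.eRk (insert e X) ≤ M.eRk X) : e ∈ M.closure X := by
  by_contra hcl
  rw [eRk_insert_eq_add_one ⟨he, hcl⟩] at h
  have : M.eRk X ≠ ⊤ := ((M.eRk_le_encard X).trans_lt hX.encard_lt_top).ne
  exact absurd h (not_le.2 (ENat.lt_add_one_iff this |>.2 le_rfl))

theorem eRk_diff_singleton_eq_of_mem_closure {M : Matroid α} {X : Set α} {e : α}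
    (he : e ∈ M.closure (X \ {e})) : M.eRk (X \ {e}) = M.eRk X := by
  by_cases heX : e ∈ X
  · have h := M.eRk_insert_closure_eq e (X \ {e})
    rw [Set.insert_eq_of_mem he, eRk_closure_eq, Set.insert_sdiff_singleton,
      Set.insert_eq_of_mem heX] at h
    exact h
  · rw [Set.sdiff_singleton_eq_self heX]

theorem IsCyclicSet.eRk_diff_singleton {M : Matroid α} {D : Set α} (hD : M.IsCyclicSet D) (e : α)
    (he : e ∈ D) : M.eRk (D \ {e}) = M.eRk D := by
  obtain ⟨C, hC, hCD, heC⟩ := hD.exists_isCircuit he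
  exact eRk_diff_singleton_eq_of_mem_closure (M.closure_subset_closure
    (Set.sdiff_subset_sdiff_left hCD) (hC.mem_closure_sdiff_singleton_of_mem heC))

/-- The elements outside the cyclic part of `X` are coloops of `X`. -/
theorem eRk_eq_eRk_cyclicPart_add (M : Matroid α) {X : Set α} (hX : X ⊆ M.E) :
    M.eRk X = M.eRk (M.cyclicPart X) + (X \ M.cyclicPart X).encard := by
  obtain ⟨I, hI⟩ := M.exists_isBasis (M.cyclicPart X) ((M.cyclicPart_subset X).trans hX)
  have hsub : I ∪ (X \ M.cyclicPart X) ⊆ X :=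
    Set.union_subset (hI.subset.trans (M.cyclicPart_subset X)) Set.sdiff_subset
  have hind : M.Indep (I ∪ (X \ M.cyclicPart X)) := by
    rw [indep_iff_forall_subset_not_isCircuit (hsub.trans hX)]
    -- A circuit inside this set lies in the cyclic part, hence inside the independent set `I`.
    intro C hCs hC
    have hCX := hC.subset_cyclicPart (hCs.trans hsub)
    refine hC.not_indep (hI.indep.subset fun e he => ?_)
    exact (hCs he).resolve_right fun h => h.2 (hCX he)
  rw [← hI.encard_eq_eRk, ← Set.encard_union_eq, ← hind.eRk_eq_encard]
  · refine le_antisymm ?_ (M.eRk_mono hsub)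
    rw [hI.eRk_eq_eRk_union, Set.union_sdiff_cancel (M.cyclicPart_subset X)]
  · exact Set.disjoint_left.2 fun e he h => h.2 (hI.subset he)

/-- Passing to the cyclic part discards only coloops, which lowers rank and cardinality equally. -/
theorem isKFoldCircuit_cyclicPart {M : Matroid α} {X : Set α} (hX : X ⊆ M.E) (hfin : X.Finite)
    {j : ℕ} (hj : M.eRk X + j = X.encard) : M.IsKFoldCircuit j (M.cyclicPart X) := by
  refine ⟨M.isCyclicSet_cyclicPart X, ?_⟩
  rw [M.eRk_eq_eRk_cyclicPart_add hX, ← Set.encard_sdiff_add_encard_of_subset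
    (M.cyclicPart_subset X), add_right_comm, add_comm (Set.encard (_ \ _))] at hj
  exact (WithTop.add_right_inj hfin.sdiff.encard_lt_top.ne).1 hj

/-- An extra element `g` of `B'` could be deleted without changing the rank of `B'`. Adding the
remaining elements to `B` one by one then gives `r(B') ≤ |B'| - j - 1`, which is too small. -/
theorem IsKFoldCircuit.eq_of_subset {M : Matroid α} {j : ℕ} {B B' : Set α}
    (hB : M.IsKFoldCircuit j B) (hB' : M.IsKFoldCircuit j B') (hfin : B'.Finite) (h : B ⊆ B') :
    B = B' := by
  refine h.antisymm fun g hg => ?_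
  by_contra hgB
  have h1 := hB'.1.eRk_diff_singleton g hg
  have h2 : M.eRk (B' \ {g}) ≤ M.eRk B + ((B' \ {g}) \ B).encard := by
    refine le_trans (M.eRk_mono ?_) (M.eRk_union_le_eRk_add_encard _ _)
    intro e he
    by_cases heB : e ∈ B
    exacts [Or.inl heB, Or.inr ⟨he, heB⟩]
  have h3 : ((B' \ {g}) \ B).encard + B.encard + 1 = B'.encard := by
    rw [Set.encard_sdiff_add_encard_of_subset (Set.subset_sdiff_singleton h hgB),
      Set.encard_sdiff_singleton_add_one hg]
  have h4 := hB.2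
  have h5 := hB'.2
  have h6 : M.eRk B ≠ ⊤ := ((M.eRk_le_encard B).trans_lt (hfin.subset h).encard_lt_top).ne
  have h7 : M.eRk B' ≠ ⊤ := ((M.eRk_le_encard B').trans_lt hfin.encard_lt_top).ne
  have h8 := (hfin.subset h).encard_lt_top.ne
  have h9 := hfin.encard_lt_top.ne
  have h10 := (hfin.sdiff (t := {g})).sdiff (t := B) |>.encard_lt_top.ne
  rw [h1] at h2
  lift M.eRk B to ℕ using h6 with a
  lift M.eRk B' to ℕ using h7 with a'
  lift B.encard to ℕ using h8 with b
  lift B'.encard to ℕ using h9 with b'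
  lift ((B' \ {g}) \ B).encard to ℕ using h10 with c
  norm_cast at *
  omega

/-- The parts of the principal partition are the complements of the cyclic parts of the
one-element deletions. -/
theorem IsKFoldCircuit.isKFoldCircuit_cyclicPart_diff {M : Matroid α} {k : ℕ} {D : Set α}
    (hD : M.IsKFoldCircuit k D) (hfin : D.Finite) {e : α} (he : e ∈ D) :
    ∃ j : ℕ, j + 1 = k ∧ M.IsKFoldCircuit j (M.cyclicPart (D \ {e})) := by
  have h1 := hD.1.eRk_diff_singleton e he
  have h2 := hD.2
  have h3 : M.eRk (D \ {e}) ≤ (D \ {e}).encard := M.eRk_le_encard _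
  have h4 := Set.encard_sdiff_singleton_add_one he
  suffices ∃ j : ℕ, j + 1 = k ∧ M.eRk (D \ {e}) + j = (D \ {e}).encard by
    obtain ⟨j, hj, h⟩ := this
    exact ⟨j, hj, isKFoldCircuit_cyclicPart (Set.sdiff_subset.trans hD.1.subset_ground)
      hfin.sdiff h⟩
  rw [h1] at h3 ⊢
  have h7 : M.eRk D ≠ ⊤ := ((M.eRk_le_encard D).trans_lt hfin.encard_lt_top).ne
  have h9 := hfin.encard_lt_top.ne
  have h10 := (hfin.sdiff (t := {e})).encard_lt_top.ne
  lift M.eRk D to ℕ using h7 with a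
  lift D.encard to ℕ using h9 with b
  lift (D \ {e}).encard to ℕ using h10 with c
  norm_cast at *
  -- The subtraction is not truncated: `r(D) = r(D \ {e}) ≤ |D| - 1` forces `k ≥ 1`.
  exact ⟨k - 1, by omega, by omega⟩

theorem IsKFoldCircuit.diff_cyclicPart_mem_principalPartition {M : Matroid α} {k : ℕ} {D : Set α}
    (hD : M.IsKFoldCircuit k D) (hfin : D.Finite) {e : α} (he : e ∈ D) :
    D \ M.cyclicPart (D \ {e}) ∈ M.principalPartition k D :=
  ⟨_, (M.cyclicPart_subset _).trans Set.sdiff_subset,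
    hD.isKFoldCircuit_cyclicPart_diff hfin he, rfl⟩

/-- The `(k - 1)`-fold circuit complementary to `A` avoids `e`, so it lies in the cyclic part of `D
\ {e}`; that has the same nullity, so the two coincide. -/
theorem IsKFoldCircuit.eq_diff_cyclicPart {M : Matroid α} {k : ℕ} {D A : Set α}
    (hD : M.IsKFoldCircuit k D) (hfin : D.Finite) (hA : A ∈ M.principalPartition k D) {e : α}
    (he : e ∈ A) : A = D \ M.cyclicPart (D \ {e}) := by
  obtain ⟨B, hBD, ⟨j, hj, hB⟩, rfl⟩ := hA
  obtain ⟨j', hj', hB'⟩ := hD.isKFoldCircuit_cyclicPart_diff hfin he.1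
  obtain rfl : j = j' := by omega
  rw [← hB.eq_of_subset hB' ((hfin.sdiff).subset (M.cyclicPart_subset _))
    (hB.1.subset_cyclicPart (Set.subset_sdiff_singleton hBD he.2))]

/-- Elements of different parts are separated by a circuit. -/
theorem IsKFoldCircuit.exists_isCircuit_of_inDifferentParts {M : Matroid α} {k : ℕ} {D : Set α}
    (hD : M.IsKFoldCircuit k D) (hfin : D.Finite) {e f : α}
    (h : InDifferentParts (M.principalPartition k D) e f) :
    ∃ C, M.IsCircuit C ∧ C ⊆ D ∧ ¬ (e ∈ C ↔ f ∈ C) := by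
  obtain ⟨A, hA, A', hA', he, hf, hne⟩ := h
  by_contra! hall
  refine hne ?_
  rw [hD.eq_diff_cyclicPart hfin hA he, hD.eq_diff_cyclicPart hfin hA' hf]
  congr 1
  -- The part of `e` is determined by the circuits in `D` that avoid `e`; under `hall` these are the
  -- circuits that avoid `f`.
  ext g
  simp only [mem_cyclicPart_iff, Set.subset_sdiff, Set.disjoint_singleton_right]
  constructor
  · rintro ⟨C, hC, ⟨hCD, heC⟩, hg⟩
    exact ⟨C, hC, ⟨hCD, fun h => heC ((hall C hC hCD).2 h)⟩, hg⟩
  · rintro ⟨C, hC, ⟨hCD, heC⟩, hg⟩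
    exact ⟨C, hC, ⟨hCD, fun h => heC ((hall C hC hCD).1 h)⟩, hg⟩

/-- The closure condition yields a circuit through `f` that avoids `e`, so `f` is not in the part of
`e`. -/
theorem IsKFoldCircuit.inDifferentParts_of_mem_closure {M : Matroid α} {k : ℕ} {D : Set α}
    (hD : M.IsKFoldCircuit k D) (hfin : D.Finite) {e f : α} (he : e ∈ D) (hf : f ∈ D)
    (hne : f ≠ e) (h : f ∈ M.closure (D \ {e, f})) :
    InDifferentParts (M.principalPartition k D) e f := by
  refine ⟨_, hD.diff_cyclicPart_mem_principalPartition hfin he,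
    _, hD.diff_cyclicPart_mem_principalPartition hfin hf,
    ⟨he, fun h => (M.cyclicPart_subset _ h).2 rfl⟩, ⟨hf, fun h => (M.cyclicPart_subset _ h).2 rfl⟩,
    fun heq => ?_⟩
  have h1 : f ∈ D \ M.cyclicPart (D \ {e}) :=
    heq ▸ ⟨hf, fun h => (M.cyclicPart_subset _ h).2 rfl⟩
  obtain ⟨C, hCs, hC, hfC⟩ := (mem_closure_iff_exists_isCircuit (by simp)).1 h
  refine h1.2 (hC.subset_cyclicPart (hCs.trans ?_) hfC)
  rintro g (rfl | hg)
  exacts [⟨hf, hne⟩, ⟨hg.1, fun h => hg.2 (Or.inl h)⟩]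

end Matroid

namespace Rigidity

variable {V : Type*}

/-! ### Equilibrium stresses and the rank of a framework -/

/-- The space of equilibrium stresses of the framework with edge set `F` and realisation `p`. -/
def stressSpace [Fintype V] {d : ℕ} (F : Set (Sym2 V)) (p : V → Fin d → ℝ) :
    Submodule ℝ (Sym2 V → ℝ) where
  carrier := {ω | (∀ e ∉ F, ω e = 0) ∧ ∀ w i, ∑ z, ω s(w, z) * (p w i - p z i) = 0}
  zero_mem' := by simp
  add_mem' := by
    rintro a b ⟨ha, ha'⟩ ⟨hb, hb'⟩
    refine ⟨fun e he => by simp [ha e he, hb e he], fun w i => ?_⟩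
    simp [add_mul, Finset.sum_add_distrib, ha', hb']
  smul_mem' := by
    rintro c a ⟨ha, ha'⟩
    refine ⟨fun e he => by simp [ha e he], fun w i => ?_⟩
    simp [mul_assoc, ← Finset.mul_sum, ha']

theorem mem_stressSpace_iff [Fintype V] {d : ℕ} {F : Set (Sym2 V)} {p : V → Fin d → ℝ}
    {ω : Sym2 V → ℝ} : ω ∈ stressSpace F p ↔
      (∀ e ∉ F, ω e = 0) ∧ ∀ w i, ∑ z, ω s(w, z) * (p w i - p z i) = 0 := Iff.rfl

open Classical in
theorem rigidityRow_apply [Fintype V] {d : ℕ} (p : V → Fin d → ℝ) (e : Sym2 V) (w : V)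
    (i : Fin d) :
    rigidityRow p e (w, i) = ∑ z, if e = s(w, z) then p w i - p z i else 0 := by
  induction e using Sym2.ind with
  | _ a b =>
    simp only [rigidityRow, Sym2.lift_mk]
    by_cases hab : a = b
    · subst hab
      have h : ∀ z, (if s(a, a) = s(w, z) then p w i - p z i else 0) = 0 := by
        intro z
        split_ifs with h
        · rw [Sym2.eq_iff] at h
          rcases h with ⟨rfl, rfl⟩ | ⟨rfl, rfl⟩ <;> simp
        · rfl
      rw [Finset.sum_eq_zero fun z _ => h z]
      simp
    · by_cases hwa : w = a
      · subst hwa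
        rw [Finset.sum_eq_single b]
        · simp [hab]
        · intro z _ hz
          rw [if_neg]
          rw [Sym2.congr_right]
          exact fun h => hz h.symm
        · simp
      · by_cases hwb : w = b
        · subst hwb
          rw [Finset.sum_eq_single a]
          · simp [hwa, Sym2.eq_swap]
          · intro z _ hz
            rw [if_neg]
            rw [Sym2.eq_swap, Sym2.congr_right]
            exact fun h => hz h.symm
          · simp
        · rw [Finset.sum_eq_zero]
          · simp [hwa, hwb]
          · intro z _
            rw [if_neg]
            rw [Sym2.eq_iff]
            rintro (⟨rfl, rfl⟩ | ⟨rfl, rfl⟩)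
            exacts [hwa rfl, hwb rfl]

theorem linearCombination_rigidityRow_apply [Fintype V] {d : ℕ} (p : V → Fin d → ℝ)
    (ω : Sym2 V →₀ ℝ) (w : V) (i : Fin d) :
    Finsupp.linearCombination ℝ (rigidityRow p) ω (w, i) =
      ∑ z, ω s(w, z) * (p w i - p z i) := by
  classical
  rw [Finsupp.linearCombination_apply, Finsupp.sum_fintype _ _ (by simp), Finset.sum_apply]
  simp only [Pi.smul_apply, smul_eq_mul, rigidityRow_apply, Finset.mul_sum]
  rw [Finset.sum_comm]
  refine Finset.sum_congr rfl fun z _ => ?_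
  simp

theorem coe_mem_stressSpace_iff [Fintype V] {d : ℕ} {F : Set (Sym2 V)} {p : V → Fin d → ℝ}
    {ω : Sym2 V →₀ ℝ} : (ω : Sym2 V → ℝ) ∈ stressSpace F p ↔
      ω ∈ Finsupp.supported ℝ ℝ F ∧ Finsupp.linearCombination ℝ (rigidityRow p) ω = 0 := by
  rw [mem_stressSpace_iff, Finsupp.mem_supported']
  refine and_congr Iff.rfl ?_
  simp only [← linearCombination_rigidityRow_apply]
  exact ⟨fun h => funext fun wi => h wi.1 wi.2, fun h w i => by rw [h]; rfl⟩

/-- The rank of the edge set `F` in the realisation `p`. -/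
noncomputable def rowRank {d : ℕ} (p : V → Fin d → ℝ) (F : Set (Sym2 V)) : ℕ :=
  Module.finrank ℝ (Submodule.span ℝ (rigidityRow p '' F))

/-- Rank-nullity for the map taking edge weights supported on `F` to the weighted sum of rigidity
rows; its kernel is the stress space. -/
theorem rowRank_add_finrank_stressSpace [Fintype V] {d : ℕ} (p : V → Fin d → ℝ)
    (F : Set (Sym2 V)) :
    rowRank p F + Module.finrank ℝ (stressSpace F p) = F.ncard := by
  classical
  have := Fintype.ofFinite F
  let L := (Finsupp.linearCombination ℝ (rigidityRow p)).domRestrict (Finsupp.supported ℝ ℝ F)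
  have h := LinearMap.finrank_range_add_finrank_ker (K := ℝ)
    (V := Finsupp.supported ℝ ℝ F) (V₂ := V × Fin d → ℝ) L
  have h1 : L.range = Submodule.span ℝ (rigidityRow p '' F) := by
    rw [Finsupp.span_image_eq_map_linearCombination, LinearMap.range_domRestrict]
  have h2 : Module.finrank ℝ (Finsupp.supported ℝ ℝ F) = F.ncard := by
    rw [(Finsupp.supportedEquivFinsupp F).finrank_eq, Module.finrank_finsupp_self,
      Set.ncard_eq_toFinset_card', Set.toFinset_card]
  let e : L.ker ≃ₗ[ℝ] stressSpace F p :=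
    { toFun := fun ω => ⟨ω.1.1, coe_mem_stressSpace_iff.2 ⟨ω.1.2, ω.2⟩⟩
      map_add' := fun _ _ => rfl
      map_smul' := fun _ _ => rfl
      invFun := fun ω =>
        have h := coe_mem_stressSpace_iff (ω := Finsupp.equivFunOnFinite.symm ω.1).1 ω.2
        ⟨⟨_, h.1⟩, h.2⟩
      left_inv := fun ω => by ext; rfl
      right_inv := fun ω => by ext; rfl }
  rw [h1, e.finrank_eq, h2] at h
  exact h

theorem rowRank_mono [Finite V] {d : ℕ} (p : V → Fin d → ℝ) {F F' : Set (Sym2 V)} (h : F ⊆ F') :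
    rowRank p F ≤ rowRank p F' := by
  have := Fintype.ofFinite V
  exact Submodule.finrank_mono (Submodule.span_mono (Set.image_mono h))

theorem rigidityRow_mem_span [Fintype V] {d : ℕ} {p : V → Fin d → ℝ} {F : Set (Sym2 V)}
    {ω : Sym2 V → ℝ} {e : Sym2 V} (hω : ω ∈ stressSpace (insert e F) p) (he : ω e ≠ 0) :
    rigidityRow p e ∈ Submodule.span ℝ (rigidityRow p '' F) := by
  classical
  have h := coe_mem_stressSpace_iff (ω := Finsupp.equivFunOnFinite.symm ω).1 hω
  have h1 := h.2
  rw [Finsupp.linearCombination_apply, Finsupp.sum_fintype _ _ (by simp),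
    ← Finset.add_sum_erase _ _ (Finset.mem_univ e), add_eq_zero_iff_eq_neg] at h1
  refine (Submodule.smul_mem_iff _ he).1 ?_
  change ω e • rigidityRow p e = _ at h1
  rw [h1]
  refine Submodule.neg_mem _ (Submodule.sum_mem _ fun f hf => ?_)
  by_cases hfF : f ∈ F
  · exact Submodule.smul_mem _ _ (Submodule.subset_span ⟨f, hfF, rfl⟩)
  · have : ω f = 0 := hω.1 f (by simp [Finset.ne_of_mem_erase hf, hfF])
    change ω f • _ ∈ _
    rw [this, zero_smul]
    exact Submodule.zero_mem _

/-- A stress that is nonzero at `e` and zero on the rest of `X` writes the row of `e` as a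
combination of rows outside `X`. -/
theorem rowRank_diff_eq [Fintype V] {d : ℕ} {p : V → Fin d → ℝ} {F X : Set (Sym2 V)}
    (h : ∀ e ∈ F ∩ X, ∃ ω ∈ stressSpace F p, ω e ≠ 0 ∧ ∀ f ∈ X, f ≠ e → ω f = 0) :
    rowRank p (F \ X) = rowRank p F := by
  unfold rowRank
  suffices Submodule.span ℝ (rigidityRow p '' (F \ X)) = Submodule.span ℝ (rigidityRow p '' F) by
    rw [this]
  refine le_antisymm (Submodule.span_mono (Set.image_mono Set.sdiff_subset)) ?_
  rw [Submodule.span_le]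
  rintro _ ⟨e, he, rfl⟩
  by_cases heX : e ∈ X
  · obtain ⟨ω, hω, hωe, h0⟩ := h e ⟨he, heX⟩
    refine rigidityRow_mem_span ⟨fun f hf => ?_, hω.2⟩ hωe
    simp only [Set.mem_insert_iff, Set.mem_sdiff, not_or, not_and_not_right] at hf
    by_cases hfF : f ∈ F
    exacts [h0 f (hf.2 hfF) hf.1, hω.1 f hfF]
  · exact Submodule.subset_span ⟨e, ⟨he, heX⟩, rfl⟩

theorem linearIndepOn_row_iff {d : ℕ} {G : SimpleGraph V} {p : V → Fin d → ℝ}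
    {F : Set (Sym2 V)} (hF : F ⊆ G.edgeSet) :
    LinearIndepOn ℝ (rigidityMatrix G p).row {e : G.edgeSet | (e : Sym2 V) ∈ F} ↔
      LinearIndepOn ℝ (rigidityRow p) F := by
  have himg : ((↑) : G.edgeSet → Sym2 V) '' {e : G.edgeSet | (e : Sym2 V) ∈ F} = F := by
    ext e
    simpa using fun h => hF h
  constructor
  · intro h
    have := LinearIndepOn.image_of_comp ((↑) : G.edgeSet → Sym2 V) (rigidityRow p) h
    rwa [himg] at this
  · intro h
    exact LinearIndepOn.comp_of_image (v := rigidityRow p) (f := ((↑) : G.edgeSet → Sym2 V))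
      (by rwa [himg]) Subtype.val_injective.injOn

theorem rowRank_eq_ncard {d : ℕ} [Finite V] {p : V → Fin d → ℝ} {I : Set (Sym2 V)}
    (h : LinearIndepOn ℝ (rigidityRow p) I) : rowRank p I = I.ncard := by
  have := Fintype.ofFinite V
  have := Fintype.ofFinite I
  rw [rowRank, Set.image_eq_range, finrank_span_eq_card h, Set.ncard_eq_toFinset_card',
    Set.toFinset_card]

/-- Rows independent at the arbitrary realisation `p` remain independent at a generic one, so
specialising never raises the rank. -/
theorem rowRank_le_eRk [Finite V] {d : ℕ} (G : SimpleGraph V) (p : V → Fin d → ℝ)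
    {F : Set (Sym2 V)} (hF : F ⊆ G.edgeSet) :
    (rowRank p F : ℕ∞) ≤ (rigidityMatroid d G).eRk F := by
  obtain ⟨q, hq⟩ := exists_isGeneric (V := V) d
  obtain ⟨I, hIF, -, hspan, hI⟩ :=
    exists_linearIndepOn_extension (linearIndepOn_empty ℝ (rigidityRow p)) (Set.empty_subset F)
  have hind : (rigidityMatroid d G).Indep I :=
    (rigidityMatroid_indep_iff_of_isGeneric G I q hq).2 ⟨hIF.trans hF,
      linearIndepOn_of_isGeneric G _ p q hq ((linearIndepOn_row_iff (hIF.trans hF)).2 hI)⟩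
  have h1 : rowRank p F = I.ncard := by
    rw [← rowRank_eq_ncard hI]
    unfold rowRank
    rw [le_antisymm (Submodule.span_le.2 hspan) (Submodule.span_mono (Set.image_mono hIF))]
  rw [h1, (Set.toFinite I).cast_ncard_eq]
  exact hind.encard_le_eRk_of_subset hIF

theorem eRk_eq_rowRank [Finite V] {d : ℕ} (G : SimpleGraph V) {p : V → Fin d → ℝ}
    (hp : IsGeneric p) {F : Set (Sym2 V)} (hF : F ⊆ G.edgeSet) :
    (rigidityMatroid d G).eRk F = rowRank p F := by
  refine le_antisymm ?_ (rowRank_le_eRk G p hF)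
  obtain ⟨I, hI⟩ := (rigidityMatroid d G).exists_isBasis F hF
  have h := ((rigidityMatroid_indep_iff_of_isGeneric G I p hp).1 hI.indep).2
  rw [linearIndepOn_row_iff (hI.subset.trans hF)] at h
  rw [← hI.encard_eq_eRk, ← (Set.toFinite I).cast_ncard_eq, ← rowRank_eq_ncard h]
  exact_mod_cast rowRank_mono p hI.subset

/-- A circuit of the rigidity matroid is the support of a stress of each generic realisation. -/
theorem exists_stress_of_isCircuit [Fintype V] {d : ℕ} {G : SimpleGraph V} {p : V → Fin d → ℝ}
    (hp : IsGeneric p) {C : Set (Sym2 V)} (hC : (rigidityMatroid d G).IsCircuit C) :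
    ∃ ω ∈ stressSpace G.edgeSet p, ∀ e, ω e ≠ 0 ↔ e ∈ C := by
  have hCG : C ⊆ G.edgeSet := hC.subset_ground
  have hdep : ¬ LinearIndepOn ℝ (rigidityRow p) C := fun h => hC.not_indep
    ((rigidityMatroid_indep_iff_of_isGeneric G C p hp).2 ⟨hCG, (linearIndepOn_row_iff hCG).2 h⟩)
  rw [linearIndepOn_iff] at hdep
  push Not at hdep
  obtain ⟨l, hl, hl0, hne⟩ := hdep
  have hsupp : ∀ e ∉ C, l e = 0 := (Finsupp.mem_supported' ℝ l).1 hl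
  refine ⟨l, coe_mem_stressSpace_iff.2 ⟨Finsupp.supported_mono hCG hl, hl0⟩, fun e =>
    ⟨fun h => by_contra fun h' => h (hsupp e h'), fun he h0 => hne ?_⟩⟩
  -- A dependency of `C` vanishing at `e` would be a dependency of the independent set `C \ {e}`,
  -- hence zero.
  have hind := ((rigidityMatroid_indep_iff_of_isGeneric G _ p hp).1
    (hC.sdiff_singleton_indep he)).2
  rw [linearIndepOn_row_iff (Set.sdiff_subset.trans hCG), linearIndepOn_iff] at hind
  refine hind l ((Finsupp.mem_supported' ℝ l).2 fun f hf => ?_) hl0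
  by_cases hfC : f ∈ C
  · have : f = e := by_contra fun h => hf ⟨hfC, h⟩
    rw [this, h0]
  · exact hsupp f hfC

/-! ### Vertex forms -/

/-- The sum over the edges `wz` at `w` of the weights `ω(wz)(s(w) - s(z))`. -/
def vertexForm [Fintype V] (ω : Sym2 V → ℝ) (s : V → ℝ) (w : V) : ℝ :=
  ∑ z, ω s(w, z) * (s w - s z)

theorem vertexForm_add_left [Fintype V] (ω ω' : Sym2 V → ℝ) (s : V → ℝ) (w : V) :
    vertexForm (ω + ω') s w = vertexForm ω s w + vertexForm ω' s w := by
  simp [vertexForm, add_mul, Finset.sum_add_distrib]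

theorem vertexForm_smul_left [Fintype V] (c : ℝ) (ω : Sym2 V → ℝ) (s : V → ℝ) (w : V) :
    vertexForm (c • ω) s w = c * vertexForm ω s w := by
  simp [vertexForm, mul_assoc, Finset.mul_sum]

theorem vertexForm_add_right [Fintype V] (ω : Sym2 V → ℝ) (s s' : V → ℝ) (w : V) :
    vertexForm ω (s + s') w = vertexForm ω s w + vertexForm ω s' w := by
  simp only [vertexForm, Pi.add_apply, ← Finset.sum_add_distrib]
  exact Finset.sum_congr rfl fun z _ => by ring

theorem vertexForm_smul_right [Fintype V] (c : ℝ) (ω : Sym2 V → ℝ) (s : V → ℝ) (w : V) :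
    vertexForm ω (c • s) w = c * vertexForm ω s w := by
  simp only [vertexForm, Pi.smul_apply, smul_eq_mul, Finset.mul_sum]
  exact Finset.sum_congr rfl fun z _ => by ring

/-- Together with `exists_add_const_ne_zero` this allows any weights `s` to be shifted to
nowhere-zero ones, as the cone realisation requires, without changing the forms. -/
theorem vertexForm_add_const [Fintype V] (ω : Sym2 V → ℝ) (s : V → ℝ) (c : ℝ) (w : V) :
    vertexForm ω (fun z => s z + c) w = vertexForm ω s w := by
  simp [vertexForm]

/-- Indicator weights read off the coefficients of the form, so the form at `w` determines the
stress on the edges at `w`. -/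
theorem vertexForm_single [Fintype V] [DecidableEq V] (ω : Sym2 V → ℝ) {w z : V} (h : z ≠ w) :
    vertexForm ω (Pi.single z 1) w = - ω s(w, z) := by
  rw [vertexForm, Finset.sum_eq_single z]
  · simp [h.symm]
  · intro y _ hy
    simp [h.symm, hy]
  · simp

theorem exists_add_const_ne_zero [Finite V] (s : V → ℝ) : ∃ c : ℝ, ∀ w, s w + c ≠ 0 := by
  obtain ⟨c, hc⟩ := (Set.finite_range fun w => - s w).exists_notMem
  exact ⟨c, fun w h => hc ⟨w, by linarith⟩⟩

/-! ### Stresses and rank of the cone -/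

/-- The realisation of the cone with the cone vertex at the origin and the vertex `w` at
`(1, p(w)) / s(w)`. -/
noncomputable def coneRealisation {d : ℕ} (p : V → Fin d → ℝ) (s : V → ℝ) :
    Option V → Fin (d + 1) → ℝ
  | none => 0
  | some w => (s w)⁻¹ • Fin.cons 1 (p w)

/-- The stress of the cone that extends a rescaling of a stress of the base. -/
noncomputable def coneStress [Fintype V] (s : V → ℝ) (ω : Sym2 V → ℝ) : Sym2 (Option V) → ℝ :=
  Sym2.lift ⟨fun
    | some a, some b => s a * s b * ω s(a, b)
    | some a, none => s a * vertexForm ω s a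
    | none, some a => s a * vertexForm ω s a
    | none, none => 0, by
      rintro (_ | a) (_ | b)
      · rfl
      · rfl
      · rfl
      · simp only [Sym2.eq_swap (a := a), mul_comm (s a)]⟩

@[simp] theorem coneStress_some_some [Fintype V] (s : V → ℝ) (ω : Sym2 V → ℝ) (a b : V) :
    coneStress s ω s(some a, some b) = s a * s b * ω s(a, b) := rfl

@[simp] theorem coneStress_some_none [Fintype V] (s : V → ℝ) (ω : Sym2 V → ℝ) (a : V) :
    coneStress s ω s(some a, none) = s a * vertexForm ω s a := rfl

@[simp] theorem coneStress_none_some [Fintype V] (s : V → ℝ) (ω : Sym2 V → ℝ) (a : V) :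
    coneStress s ω s(none, some a) = s a * vertexForm ω s a := rfl

@[simp] theorem coneStress_none_none [Fintype V] (s : V → ℝ) (ω : Sym2 V → ℝ) :
    coneStress s ω s(none, none) = 0 := rfl

/-- The summand is antisymmetric in `w` and `z`. Consequently equilibrium at all vertices but one
implies it at the last, which is how the cone vertex is treated. -/
theorem sum_sum_stress_eq_zero [Fintype V] (ω : Sym2 V → ℝ) (f : V → ℝ) :
    ∑ w, ∑ z, ω s(w, z) * (f w - f z) = 0 := by
  have h : ∑ w, ∑ z, ω s(w, z) * (f w - f z) = - ∑ w, ∑ z, ω s(w, z) * (f w - f z) := by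
    conv_lhs => rw [Finset.sum_comm]
    rw [← Finset.sum_neg_distrib]
    refine Finset.sum_congr rfl fun w _ => ?_
    rw [← Finset.sum_neg_distrib]
    refine Finset.sum_congr rfl fun z _ => ?_
    rw [Sym2.eq_swap]
    ring
  linarith

theorem coneStress_mem_stressSpace [Fintype V] {d : ℕ} {G : SimpleGraph V} {p : V → Fin d → ℝ}
    {s : V → ℝ} (hs : ∀ w, s w ≠ 0) {ω : Sym2 V → ℝ} (hω : ω ∈ stressSpace G.edgeSet p) :
    coneStress s ω ∈ stressSpace (cone G).edgeSet (coneRealisation p s) := by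
  have hsome : ∀ w i, ∑ z, coneStress s ω s(some w, z) *
      (coneRealisation p s (some w) i - coneRealisation p s z i) = 0 := by
    intro w i
    rw [Fintype.sum_option]
    refine Fin.cases ?_ (fun i => ?_) i
    · simp only [coneStress_some_none, coneStress_some_some, coneRealisation, Pi.smul_apply,
        Fin.cons_zero, Pi.zero_apply, vertexForm, smul_eq_mul, mul_one, sub_zero]
      rw [mul_right_comm, mul_inv_cancel₀ (hs w), one_mul, ← Finset.sum_add_distrib]
      refine Finset.sum_eq_zero fun z _ => ?_
      have := hs w
      have := hs z
      field_simp
      ring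
    · simp only [coneStress_some_none, coneStress_some_some, coneRealisation, Pi.smul_apply,
        Fin.cons_succ, Pi.zero_apply, vertexForm, smul_eq_mul, sub_zero]
      rw [show s w * ∑ z, ω s(w, z) * (s w - s z) = ∑ z, s w * (ω s(w, z) * (s w - s z)) from
        Finset.mul_sum _ _ _, Finset.sum_mul, ← Finset.sum_add_distrib,
        ← mul_zero (s w), ← hω.2 w i, Finset.mul_sum]
      refine Finset.sum_congr rfl fun z _ => ?_
      have := hs w
      have := hs z
      field_simp
      ring
  refine ⟨fun e he => ?_, fun w i => ?_⟩
  · induction e using Sym2.ind with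
    | _ a b =>
      rcases a with _ | a <;> rcases b with _ | b
      · rfl
      · exact absurd trivial he
      · exact absurd trivial he
      · have : ω s(a, b) = 0 := hω.1 _ he
        simp [this]
  · rcases w with _ | w
    · have h := sum_sum_stress_eq_zero (coneStress s ω) (fun w => coneRealisation p s w i)
      rw [Fintype.sum_option, Finset.sum_eq_zero fun w _ => hsome w i, add_zero] at h
      exact h
    · exact hsome w i

/-- The stress of the base that is induced by a stress of the cone. -/
noncomputable def baseStress (s : V → ℝ) (ω : Sym2 (Option V) → ℝ) : Sym2 V → ℝ :=
  Sym2.lift ⟨fun a b => (s a)⁻¹ * (s b)⁻¹ * ω s(some a, some b), fun a b => by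
    simp only [Sym2.eq_swap (a := some a), mul_comm (s a)⁻¹]⟩

@[simp] theorem baseStress_mk (s : V → ℝ) (ω : Sym2 (Option V) → ℝ) (a b : V) :
    baseStress s ω s(a, b) = (s a)⁻¹ * (s b)⁻¹ * ω s(some a, some b) := rfl

/-- The equilibrium condition in the coordinate 0, where `w` sits at `1 / s(w)`: it determines the
stress on the cone edge at `w` from the base edges. -/
theorem stressSpace_cone_zero [Fintype V] {d : ℕ} {F : Set (Sym2 (Option V))}
    {p : V → Fin d → ℝ} {s : V → ℝ} {ω : Sym2 (Option V) → ℝ}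
    (hω : ω ∈ stressSpace F (coneRealisation p s)) (w : V) :
    ω s(some w, none) * (s w)⁻¹ + ∑ z, ω s(some w, some z) * ((s w)⁻¹ - (s z)⁻¹) = 0 := by
  have h0 := hω.2 (some w) 0
  simpa [Fintype.sum_option, coneRealisation] using h0

theorem baseStress_mem_stressSpace [Fintype V] {d : ℕ} {G : SimpleGraph V} {p : V → Fin d → ℝ}
    {s : V → ℝ} {ω : Sym2 (Option V) → ℝ}
    (hω : ω ∈ stressSpace (cone G).edgeSet (coneRealisation p s)) :
    baseStress s ω ∈ stressSpace G.edgeSet p := by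
  refine ⟨fun e he => ?_, fun w i => ?_⟩
  · induction e using Sym2.ind with
    | _ a b =>
      have : ω s(some a, some b) = 0 := hω.1 _ he
      simp [this]
  · have h0 := stressSpace_cone_zero hω w
    have h1 := hω.2 (some w) i.succ
    simp only [Fintype.sum_option, coneRealisation, Pi.smul_apply, Fin.cons_succ, smul_eq_mul,
      Pi.zero_apply, sub_zero] at h1
    -- Subtracting `p w i` times the equation in coordinate 0 eliminates the cone edge.
    have h2 : ∑ z, ω s(some w, some z) * ((s w)⁻¹ * p w i - (s z)⁻¹ * p z i) -
        (∑ z, ω s(some w, some z) * ((s w)⁻¹ - (s z)⁻¹)) * p w i = 0 := by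
      linear_combination h1 - h0 * p w i
    rw [Finset.sum_mul, ← Finset.sum_sub_distrib] at h2
    rw [← mul_zero (s w)⁻¹, ← h2, Finset.mul_sum]
    refine Finset.sum_congr rfl fun z _ => ?_
    rw [baseStress_mk]
    ring

theorem finrank_stressSpace_cone [Fintype V] {d : ℕ} (G : SimpleGraph V) (p : V → Fin d → ℝ)
    {s : V → ℝ} (hs : ∀ w, s w ≠ 0) :
    Module.finrank ℝ (stressSpace (cone G).edgeSet (coneRealisation p s)) =
      Module.finrank ℝ (stressSpace G.edgeSet p) := by
  apply le_antisymm
  · let f : stressSpace (cone G).edgeSet (coneRealisation p s) →ₗ[ℝ] stressSpace G.edgeSet p :=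
      { toFun := fun ω => ⟨baseStress s ω, baseStress_mem_stressSpace ω.2⟩
        map_add' := fun ω ω' => by
          ext e
          induction e using Sym2.ind with
          | _ a b => simp [mul_add]
        map_smul' := fun c ω => by
          ext e
          induction e using Sym2.ind with
          | _ a b => simp [mul_left_comm] }
    refine LinearMap.finrank_le_finrank_of_injective (f := f) ?_
    rw [injective_iff_map_eq_zero]
    intro ω h
    have hss : ∀ a b, (ω : Sym2 (Option V) → ℝ) s(some a, some b) = 0 := by
      intro a b
      have h' := congrFun (congrArg Subtype.val h) s(a, b)
      change baseStress s ω s(a, b) = 0 at h'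
      simpa [hs] using h'
    have hsn : ∀ a, (ω : Sym2 (Option V) → ℝ) s(some a, none) = 0 := by
      intro a
      have h0 := stressSpace_cone_zero ω.2 a
      simpa [hss, hs] using h0
    ext e
    induction e using Sym2.ind with
    | _ a b =>
      rcases a with _ | a <;> rcases b with _ | b
      · exact ω.2.1 _ id
      · rw [Sym2.eq_swap]
        exact hsn b
      · exact hsn a
      · exact hss a b
  · let f : stressSpace G.edgeSet p →ₗ[ℝ] stressSpace (cone G).edgeSet (coneRealisation p s) :=
      { toFun := fun ω => ⟨coneStress s ω, coneStress_mem_stressSpace hs ω.2⟩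
        map_add' := fun ω ω' => by
          ext e
          induction e using Sym2.ind with
          | _ a b =>
            rcases a with _ | a <;> rcases b with _ | b <;>
              simp [mul_add, vertexForm_add_left]
        map_smul' := fun c ω => by
          ext e
          induction e using Sym2.ind with
          | _ a b =>
            rcases a with _ | a <;> rcases b with _ | b <;>
              simp [mul_left_comm, vertexForm_smul_left] }
    refine LinearMap.finrank_le_finrank_of_injective (f := f) ?_
    rw [injective_iff_map_eq_zero]
    intro ω h
    ext e
    induction e using Sym2.ind with
    | _ a b =>
      have h' := congrFun (congrArg Subtype.val h) s(some a, some b)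
      change coneStress s ω s(some a, some b) = 0 at h'
      simpa [hs] using h'

/-- Translate the cone vertex to the origin and take `s(w)` to be the inverse of the first
coordinate of `w`, which is nonzero because generic coordinates are distinct. -/
theorem exists_coneRealisation_of_isGeneric {d : ℕ} {q : Option V → Fin (d + 1) → ℝ}
    (hq : IsGeneric q) : ∃ (p : V → Fin d → ℝ) (s : V → ℝ), (∀ w, s w ≠ 0) ∧
      ∀ w i, coneRealisation p s w i = q w i - q none i := by
  have hne : ∀ w : V, q (some w) 0 - q none 0 ≠ 0 := fun w h => by
    have h1 : (some w, (0 : Fin (d + 1))) = (none, 0) :=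
      AlgebraicIndependent.injective hq (sub_eq_zero.1 h)
    simp at h1
  refine ⟨fun w i => (q (some w) i.succ - q none i.succ) / (q (some w) 0 - q none 0),
    fun w => (q (some w) 0 - q none 0)⁻¹, fun w => inv_ne_zero (hne w), ?_⟩
  rintro (_ | w) i
  · simp [coneRealisation]
  · refine Fin.cases ?_ (fun i => ?_) i
    · simp [coneRealisation]
    · simp [coneRealisation, mul_div_cancel₀ _ (hne w)]

theorem stressSpace_congr_sub [Fintype V] {d : ℕ} (F : Set (Sym2 V)) {p q : V → Fin d → ℝ}
    (c : Fin d → ℝ) (h : ∀ w i, p w i = q w i - c i) : stressSpace F p = stressSpace F q := by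
  ext ω
  simp [mem_stressSpace_iff, h]

/-- Coning preserves the nullity of the edge set. -/
theorem eRk_cone_add [Fintype V] {d k : ℕ} {G : SimpleGraph V}
    (h : (rigidityMatroid d G).eRk G.edgeSet + k = G.edgeSet.encard) :
    (rigidityMatroid (d + 1) (cone G)).eRk (cone G).edgeSet + k = (cone G).edgeSet.encard ∧
      ∀ p : V → Fin d → ℝ, IsGeneric p → ∀ s : V → ℝ, (∀ w, s w ≠ 0) →
        (rigidityMatroid (d + 1) (cone G)).eRk (cone G).edgeSet =
          rowRank (coneRealisation p s) (cone G).edgeSet := by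
  obtain ⟨q, hq⟩ := exists_isGeneric (V := Option V) (d + 1)
  obtain ⟨p', s', hs', hq'⟩ := exists_coneRealisation_of_isGeneric hq
  have hfin : ∀ p : V → Fin d → ℝ, IsGeneric p →
      Module.finrank ℝ (stressSpace G.edgeSet p) = k := by
    intro p hp
    have h1 := rowRank_add_finrank_stressSpace p G.edgeSet
    rw [eRk_eq_rowRank G hp subset_rfl, ← (Set.toFinite G.edgeSet).cast_ncard_eq] at h
    norm_cast at h
    omega
  -- Genericity of the projection `p'` is not needed. Its nullity is at least `k`, so the rank of
  -- `q` is at most `|E| - k`; the special realisations with generic base have exactly this rank and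
  -- cannot exceed that of `q`.
  have hge : k ≤ Module.finrank ℝ (stressSpace G.edgeSet p') := by
    have h1 := rowRank_add_finrank_stressSpace p' G.edgeSet
    have h2 := rowRank_le_eRk G p' (subset_refl G.edgeSet)
    obtain ⟨p, hp⟩ := exists_isGeneric (V := V) d
    rw [eRk_eq_rowRank G hp subset_rfl] at h h2
    rw [← (Set.toFinite G.edgeSet).cast_ncard_eq] at h
    norm_cast at h h2
    omega
  have h3 := rowRank_add_finrank_stressSpace q (cone G).edgeSet
  rw [← stressSpace_congr_sub _ _ hq', finrank_stressSpace_cone G p' hs'] at h3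
  have h4 : ∀ p : V → Fin d → ℝ, IsGeneric p → ∀ s : V → ℝ, (∀ w, s w ≠ 0) →
      rowRank (coneRealisation p s) (cone G).edgeSet + k = (cone G).edgeSet.ncard ∧
      rowRank q (cone G).edgeSet = rowRank (coneRealisation p s) (cone G).edgeSet := by
    intro p hp s hs
    have h5 := rowRank_add_finrank_stressSpace (coneRealisation p s) (cone G).edgeSet
    rw [finrank_stressSpace_cone G p hs, hfin p hp] at h5
    have h6 := rowRank_le_eRk (cone G) (coneRealisation p s) (subset_refl (cone G).edgeSet)
    rw [eRk_eq_rowRank (cone G) hq subset_rfl] at h6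
    norm_cast at h6
    omega
  rw [eRk_eq_rowRank (cone G) hq subset_rfl, ← (Set.toFinite (cone G).edgeSet).cast_ncard_eq]
  constructor
  · obtain ⟨p, hp⟩ := exists_isGeneric (V := V) d
    have h7 := h4 p hp 1 (by simp)
    norm_cast
    omega
  · intro p hp s hs
    exact_mod_cast (h4 p hp s hs).2

/-- A set of edges whose coordinates are separated by the stresses of a special realisation of the
cone may be deleted without changing the rank of the cone. -/
theorem eRk_cone_le_of_stress [Fintype V] {d k : ℕ} {G : SimpleGraph V}
    (h : (rigidityMatroid d G).eRk G.edgeSet + k = G.edgeSet.encard)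
    {p : V → Fin d → ℝ} (hp : IsGeneric p) {s : V → ℝ} (hs : ∀ w, s w ≠ 0)
    {X : Set (Sym2 (Option V))}
    (hX : ∀ e ∈ X, ∃ ω ∈ stressSpace G.edgeSet p, coneStress s ω e ≠ 0 ∧
      ∀ f ∈ X, f ≠ e → coneStress s ω f = 0) :
    (rigidityMatroid (d + 1) (cone G)).eRk (cone G).edgeSet ≤
      (rigidityMatroid (d + 1) (cone G)).eRk ((cone G).edgeSet \ X) := by
  -- The generic rank of the whole cone is the special rank, which survives the deletion of `X` and
  -- is at most the generic rank of what remains.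
  rw [(eRk_cone_add h).2 p hp s hs, ← rowRank_diff_eq (X := X)]
  · exact rowRank_le_eRk _ _ Set.sdiff_subset
  · rintro e ⟨-, he⟩
    obtain ⟨ω, hω, hωe, h0⟩ := hX e he
    exact ⟨_, coneStress_mem_stressSpace hs hω, hωe, h0⟩

/-! ### Proportional families of linear forms -/

/-- Linear forms that divide each other's products are proportional with a uniform factor. -/
theorem exists_eq_smul_of_mul_eq_mul {K N ι : Type*} [Field K] [AddCommGroup N] [Module K N]
    {F H : ι → Module.Dual K N} (h : ∀ i j t, F i t * H j t = F j t * H i t) {i j : ι} {t : N}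
    (hi : F i ≠ 0) (hit : F i t = 0) (hjt : F j t ≠ 0) : ∃ c : K, ∀ m, H m = c • F m := by
  have hker : ∀ r, F j r ≠ 0 → F i r = 0 → H i r = 0 := by
    intro r hj hr
    have := h i j r
    rw [hr, zero_mul] at this
    exact (mul_eq_zero.1 this.symm).resolve_left hj
  have hker' : ∀ r, F i r = 0 → H i r = 0 := by
    intro r hr
    by_cases hj : F j r = 0
    · have h1 := hker (r + t) (by simpa [hj] using hjt) (by simp [hr, hit])
      rwa [map_add, hker t hjt hit, add_zero] at h1
    · exact hker r hj hr
  obtain ⟨r, hr⟩ : ∃ r, F i r ≠ 0 := by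
    by_contra! hall
    exact hi (LinearMap.ext hall)
  have hHi : ∀ y, H i y = H i r / F i r * F i y := by
    intro y
    have h1 := hker' (y - (F i y / F i r) • r) (by simp [hr])
    rw [map_sub, map_smul, smul_eq_mul, sub_eq_zero] at h1
    rw [h1]
    ring
  refine ⟨H i r / F i r, fun m => LinearMap.ext fun y => ?_⟩
  -- The product of `F i` and `H m - c F m` vanishes identically; since `F i` is nonzero, the other
  -- linear form must be zero, as evaluation at `r` and `y + r` shows.
  have hprod : ∀ y, F i y = 0 ∨ H m y - H i r / F i r * F m y = 0 := by
    intro y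
    have h1 := h i m y
    rw [hHi y] at h1
    rw [← mul_eq_zero]
    linear_combination h1
  have hr' := (hprod r).resolve_left hr
  rw [LinearMap.smul_apply, smul_eq_mul, ← sub_eq_zero]
  rcases hprod y with hy | hy
  · have h2 := (hprod (y + r)).resolve_left (by simpa [hy] using hr)
    rw [map_add, map_add] at h2
    linear_combination h2 - hr'
  · exact hy

/-- `vertexForm` as a linear form in the vertex weights. -/
def vertexDual [Fintype V] (ω : Sym2 V → ℝ) (w : V) : Module.Dual ℝ (V → ℝ) where
  toFun s := vertexForm ω s w
  map_add' s s' := vertexForm_add_right ω s s' w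
  map_smul' c s := vertexForm_smul_right c ω s w

theorem exists_stress_ne_zero [Fintype V] {d k : ℕ} {G : SimpleGraph V}
    (hG : IsKFoldRigidityCircuit d k G) {p : V → Fin d → ℝ} (hp : IsGeneric p) {e : Sym2 V}
    (he : e ∈ G.edgeSet) : ∃ ω ∈ stressSpace G.edgeSet p, ω e ≠ 0 := by
  obtain ⟨C, hC, -, heC⟩ := hG.1.exists_isCircuit he
  obtain ⟨ω, hω, h⟩ := exists_stress_of_isCircuit hp hC
  exact ⟨ω, hω, (h e).2 heC⟩

/-! ### Cyclicity of the cone and separation of two cone edges -/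

/-- The cone of a `k`-fold circuit without isolated vertices is a `k`-fold circuit. -/
theorem IsKFoldRigidityCircuit.cone [Fintype V] {d k : ℕ} {G : SimpleGraph V}
    (hG : IsKFoldRigidityCircuit d k G) (hiso : ∀ w : V, ∃ w' : V, G.Adj w w') :
    IsKFoldRigidityCircuit (d + 1) k (cone G) := by
  classical
  obtain ⟨p, hp⟩ := exists_isGeneric (V := V) d
  refine ⟨Matroid.isCyclicSet_of_forall_mem_closure fun e he =>
    Matroid.mem_closure_of_eRk_insert_le (Set.toFinite _) he ?_, (eRk_cone_add hG.2).1⟩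
  rw [Set.insert_sdiff_singleton, Set.insert_eq_of_mem he]
  obtain ⟨s, hs, ω, hω, hne⟩ : ∃ s : V → ℝ, (∀ w, s w ≠ 0) ∧
      ∃ ω ∈ stressSpace G.edgeSet p, coneStress s ω e ≠ 0 := by
    have hnone : ∀ w, ∃ s : V → ℝ, (∀ w, s w ≠ 0) ∧
        ∃ ω ∈ stressSpace G.edgeSet p, coneStress s ω s(none, some w) ≠ 0 := by
      intro w
      obtain ⟨z, hz⟩ := hiso w
      obtain ⟨ω, hω, hne⟩ := exists_stress_ne_zero hG hp (e := s(w, z)) hz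
      -- With the indicator of `z` as weights, up to a shift, the form at `w` is `-ω(wz)`, nonzero
      -- by the choice of `ω`.
      obtain ⟨c, hc⟩ := exists_add_const_ne_zero (Pi.single z (1 : ℝ) : V → ℝ)
      refine ⟨_, hc, ω, hω, ?_⟩
      rw [coneStress_none_some, vertexForm_add_const, vertexForm_single _ hz.ne']
      exact mul_ne_zero (hc w) (neg_ne_zero.2 hne)
    induction e using Sym2.ind with
    | _ a b =>
      rcases a with _ | a <;> rcases b with _ | b
      · exact he.elim
      · exact hnone b
      · rw [Sym2.eq_swap]
        exact hnone a
      · obtain ⟨ω, hω, hne⟩ := exists_stress_ne_zero hG hp (e := s(a, b)) he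
        exact ⟨1, by simp, ω, hω, by simpa using hne⟩
  refine eRk_cone_le_of_stress hG.2 hp hs ?_
  rintro _ rfl
  exact ⟨ω, hω, hne, fun f hf hfe => absurd hf hfe⟩

/-- Two cone edges are separated as soon as their vertex forms are independent for some choice of
vertex weights. -/
theorem inDifferentParts_cone_of_vertexForm [Fintype V] {d k : ℕ} {G : SimpleGraph V}
    (hG : IsKFoldRigidityCircuit d k G) (hiso : ∀ w : V, ∃ w' : V, G.Adj w w')
    {p : V → Fin d → ℝ} (hp : IsGeneric p) {u x : V} (hux : u ≠ x) {s : V → ℝ}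
    {ω μ : Sym2 V → ℝ} (hω : ω ∈ stressSpace G.edgeSet p) (hμ : μ ∈ stressSpace G.edgeSet p)
    (h : vertexForm ω s u * vertexForm μ s x - vertexForm μ s u * vertexForm ω s x ≠ 0) :
    InDifferentParts (edgePartition (d + 1) k (cone G)) s(none, some u) s(none, some x) := by
  obtain ⟨c, hc⟩ := exists_add_const_ne_zero s
  have hne : s(none, some x) ≠ s(none, some u) := by
    simpa using hux.symm
  have hu : s(none, some u) ∈ (cone G).edgeSet := trivial
  have hx : s(none, some x) ∈ (cone G).edgeSet := trivial
  refine (hG.cone hiso).inDifferentParts_of_mem_closure (Set.toFinite _) hu hx hne ?_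
  refine Matroid.mem_closure_of_eRk_insert_le (Set.toFinite _) hx ?_
  refine (Matroid.eRk_mono _ (Set.insert_subset hx Set.sdiff_subset)).trans ?_
  refine eRk_cone_le_of_stress hG.2 hp hc ?_
  have hform : ∀ (a b : ℝ) (w : V), coneStress (fun z => s z + c) (a • ω + b • μ)
      s(none, some w) = (s w + c) * (a * vertexForm ω s w + b * vertexForm μ s w) := by
    intro a b w
    rw [coneStress_none_some, vertexForm_add_const, vertexForm_add_left, vertexForm_smul_left,
      vertexForm_smul_left]
  have hmem : ∀ a b : ℝ, a • ω + b • μ ∈ stressSpace G.edgeSet p := fun a b =>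
    add_mem (Submodule.smul_mem _ a hω) (Submodule.smul_mem _ b hμ)
  -- The nonzero determinant `h` allows a combination of `ω` and `μ` to be chosen whose form
  -- vanishes at one of `u`, `x` but not at the other.
  rintro e (rfl | rfl)
  · refine ⟨_, hmem (vertexForm μ s x) (-vertexForm ω s x), ?_, ?_⟩
    · rw [hform]
      refine mul_ne_zero (hc u) fun h0 => h ?_
      linear_combination h0
    · rintro f (rfl | rfl) hf
      · exact absurd rfl hf
      · rw [hform]
        ring
  · refine ⟨_, hmem (-vertexForm μ s u) (vertexForm ω s u), ?_, ?_⟩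
    · rw [hform]
      refine mul_ne_zero (hc x) fun h0 => h ?_
      linear_combination h0
    · rintro f (rfl | rfl) hf
      · rw [hform]
        ring
      · exact absurd rfl hf

/-- At a technicolour vertex two edges are separated by a stress. -/
theorem IsTechnicolour.exists_stress [Fintype V] {d k : ℕ} {G : SimpleGraph V}
    (hG : IsKFoldRigidityCircuit d k G) {p : V → Fin d → ℝ} (hp : IsGeneric p) {u : V}
    (hiso : ∃ w, G.Adj u w) (hu : IsTechnicolour G (edgePartition d k G) u) :
    ∃ a b, G.Adj u a ∧ G.Adj u b ∧
      ∃ ω ∈ stressSpace G.edgeSet p, ω s(u, a) = 0 ∧ ω s(u, b) ≠ 0 := by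
  obtain ⟨a, ha⟩ := hiso
  -- Without such a stress, no circuit avoiding `ua` contains an edge at `u`, so all edges at `u`
  -- lie in the part of `ua`.
  by_contra! hall
  refine hu ⟨_, hG.diff_cyclicPart_mem_principalPartition (Set.toFinite _)
    (e := s(u, a)) ha, ?_⟩
  rintro f ⟨hf, huf⟩
  refine ⟨hf, fun hfC => ?_⟩
  obtain ⟨C, hC, hCs, hfC⟩ := Matroid.mem_cyclicPart_iff.1 hfC
  obtain ⟨b, rfl⟩ := huf
  obtain ⟨ω, hω, h⟩ := exists_stress_of_isCircuit hp hC
  refine (h _).2 hfC (hall a b ha hf ω hω ?_)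
  by_contra h0
  exact (hCs ((h _).1 h0)).2 rfl

/-- Some vertex weights make the vertex forms at `u` and `x` independent on the stress space. -/
theorem exists_vertexForm_ne [Fintype V] {d k : ℕ} {G : SimpleGraph V}
    (hG : IsKFoldRigidityCircuit d k G) (hiso : ∀ w : V, ∃ w' : V, G.Adj w w')
    {p : V → Fin d → ℝ} (hp : IsGeneric p) {u x : V}
    (hu : IsTechnicolour G (edgePartition d k G) u)
    (h : (∃ z ∈ G.neighborSet u ∩ G.neighborSet x,
            InDifferentParts (edgePartition d k G) s(u, z) s(x, z)) ∨
          G.neighborSet u \ {x} ≠ G.neighborSet x \ {u}) :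
    ∃ s : V → ℝ, ∃ ω ∈ stressSpace G.edgeSet p, ∃ μ ∈ stressSpace G.edgeSet p,
      vertexForm ω s u * vertexForm μ s x - vertexForm μ s u * vertexForm ω s x ≠ 0 := by
  classical
  by_contra! hall
  obtain ⟨a, b, ha, hb, ω₀, hω₀, h0a, h0b⟩ := IsTechnicolour.exists_stress hG hp (hiso u) hu
  obtain ⟨μ₀, hμ₀, h0μ⟩ := exists_stress_ne_zero hG hp (e := s(u, a)) ha
  have hsingle : ∀ (ω : Sym2 V → ℝ) {w z : V}, z ≠ w →
      vertexDual ω w (Pi.single z 1) = - ω s(w, z) := fun ω _ _ => vertexForm_single ω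
  -- The indicator of `a` serves as `t`: the form of `ω₀` at `u` vanishes there, that of `μ₀` does
  -- not, and the former is nonzero through its coefficient at `b`.
  obtain ⟨c, hc⟩ := exists_eq_smul_of_mul_eq_mul
    (F := fun ω : stressSpace G.edgeSet p => vertexDual ω.1 u)
    (H := fun ω : stressSpace G.edgeSet p => vertexDual ω.1 x)
    (fun ω μ s => sub_eq_zero.1 (hall s ω.1 ω.2 μ.1 μ.2)) (i := ⟨ω₀, hω₀⟩) (j := ⟨μ₀, hμ₀⟩)
    (t := Pi.single a 1)
    (fun h => h0b (by
      have := hsingle ω₀ hb.ne'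
      rw [show vertexDual ω₀ u = 0 from h] at this
      simpa using this.symm))
    (by rw [hsingle ω₀ ha.ne', h0a, neg_zero])
    (by rw [hsingle μ₀ ha.ne']; exact neg_ne_zero.2 h0μ)
  have hprop : ∀ ω ∈ stressSpace G.edgeSet p, ∀ z, z ≠ u → z ≠ x →
      ω s(x, z) = c * ω s(u, z) := by
    intro ω hω z hzu hzx
    have h1 := LinearMap.congr_fun (hc ⟨ω, hω⟩) (Pi.single z 1)
    rw [LinearMap.smul_apply, hsingle ω hzu, hsingle ω hzx, smul_eq_mul] at h1
    linear_combination -h1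
  -- If `c = 0`, every stress would vanish on the edges at `x`, although each edge supports some
  -- stress.
  have hc0 : c ≠ 0 := by
    rintro rfl
    obtain ⟨z, hz⟩ := hiso x
    obtain ⟨ω, hω, hne⟩ := exists_stress_ne_zero hG hp (e := s(x, z)) hz
    have h1 := LinearMap.congr_fun (hc ⟨ω, hω⟩) (Pi.single z 1)
    rw [LinearMap.smul_apply, hsingle ω hz.ne', zero_smul, neg_eq_zero] at h1
    exact hne h1
  rcases h with ⟨z, ⟨hzu, hzx⟩, hz⟩ | h
  -- Under (a), a circuit containing exactly one of `uz`, `xz` gives a stress that violates the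
  -- proportionality.
  · obtain ⟨C, hC, -, hCne⟩ := hG.exists_isCircuit_of_inDifferentParts (Set.toFinite _) hz
    obtain ⟨ω, hω, hsupp⟩ := exists_stress_of_isCircuit hp hC
    refine hCne ?_
    rw [← hsupp, ← hsupp, hprop ω hω z hzu.ne' hzx.ne']
    simp [hc0]
  -- Under (b), proportionality shows that a stress supported on one of `uz`, `xz` is nonzero on the
  -- other, so both are edges.
  · refine h (Set.ext fun z => ?_)
    simp only [Set.mem_sdiff, SimpleGraph.mem_neighborSet, Set.mem_singleton_iff]
    constructor
    · rintro ⟨hz, hzx⟩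
      refine ⟨by_contra fun hn => ?_, hz.ne'⟩
      obtain ⟨ω, hω, hne⟩ := exists_stress_ne_zero hG hp (e := s(u, z)) hz
      have h1 := hprop ω hω z hz.ne' hzx
      rw [hω.1 s(x, z) hn] at h1
      exact mul_ne_zero hc0 hne h1.symm
    · rintro ⟨hz, hzu⟩
      refine ⟨by_contra fun hn => ?_, hz.ne'⟩
      obtain ⟨ω, hω, hne⟩ := exists_stress_ne_zero hG hp (e := s(x, z)) hz
      have h1 := hprop ω hω z hzu hz.ne'
      rw [hω.1 s(u, z) hn, mul_zero] at h1
      exact hne h1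

end Rigidity

theorem mainTheorem2 {V : Type*} [Finite V] (d k : ℕ) (G : SimpleGraph V)
    (hG : Rigidity.IsKFoldRigidityCircuit d k G)
    (hiso : ∀ w : V, ∃ w' : V, G.Adj w w')
    (u x : V) (hux : u ≠ x)
    (hu : Rigidity.IsTechnicolour G (Rigidity.edgePartition d k G) u)
    (hx : Rigidity.IsTechnicolour G (Rigidity.edgePartition d k G) x)
    (h : (∃ z ∈ G.neighborSet u ∩ G.neighborSet x,
            InDifferentParts (Rigidity.edgePartition d k G) s(u, z) s(x, z)) ∨
          G.neighborSet u \ {x} ≠ G.neighborSet x \ {u}) :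
    Rigidity.IsKFoldRigidityCircuit (d + 1) k (Rigidity.cone G) ∧
      InDifferentParts (Rigidity.edgePartition (d + 1) k (Rigidity.cone G))
        s(none, some u) s(none, some x) := by
  have := Fintype.ofFinite V
  obtain ⟨p, hp⟩ := Rigidity.exists_isGeneric (V := V) d
  obtain ⟨s, ω, hω, μ, hμ, hne⟩ := Rigidity.exists_vertexForm_ne hG hiso hp hu h
  exact ⟨hG.cone hiso, Rigidity.inDifferentParts_cone_of_vertexForm hG hiso hp hux hω hμ hne⟩
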